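/- A right-preordered group is a group $(X,+,0)$ (written additively, not necessarily abelian) with a preorder $\le$ such that $x\le y$ implies $x+z\le y+z$ for all $x,y,z\in X$; its positive cone is the submonoid $P_X=\{x\in X : 0\le x\}$. Let $\mathbf{ROrdGrp}$ be the category of right-preordered groups and monotone group homomorphisms; it is pointed and finitely complete. Two morphisms $f\colon X\to B$, $g\colon Z\to B$ of a category are jointly strongly epimorphic if they are jointly epimorphic and, for every monomorphism $m\colon M\to N$ and all $v\colon B\to N$, $a\colon X\to M$, $b\colon Z\to M$ with $ma=vf$ and $mb=vg$, there is $d\colon B\to M$ with $md=v$, $df=a$ and $dg=b$. In a pointed finitely complete category, a point over $B$ is a pair $(f\colon A\to B,\ s\colon B\to A)$ with $fs=1_B$. It is strong if $\ker f$ and $s$ are jointly strongly epimorphic, and stably strong if for every morphism $g\colon D\to B$ the pullback point $(A\times_B D\to D,\ \langle sg,1_D\rangle)$ is strong. An object $Y$ is - a protomodular object if every point over $Y$ is stably strong; - a Mal'tsev object if for all points $(f\colon A\to Y,s)$ and $(g\colon D\to Y,t)$ over $Y$ the morphisms $\langle 1_A,tf\rangle\colon A\to A\times_Y D$ and $\langle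 sg,1_D\rangle\colon D\to A\times_Y D$ are jointly strongly epimorphic; - a strongly unital object if the point $(\pi_2\colon Y\times Y\to Y,\ \langle 1_Y,1_Y\rangle)$ is stably strong. Theorem. For a right-preordered group $Y$, the following conditions are equivalent: 1. $Y$ is a protomodular object in $\mathbf{ROrdGrp}$; 2. $Y$ is a Mal'tsev object in $\mathbf{ROrdGrp}$; 3. $Y$ is a strongly unital object in $\mathbf{ROrdGrp}$; 4. the positive cone $P_Y$ is a group, i.e. every element of the monoid $P_Y$ has an inverse in $P_Y$; 5. the preorder relation $\le$ on $Y$ is an equivalence relation. -/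

import Mathlib

open CategoryTheory CategoryTheory.Limits

universe v u

namespace CategoryTheory

section Points

variable {C : Type u} [Category.{v} C]

/-- Two morphisms `f : X ⟶ B` and `g : Y ⟶ B` are jointly strongly epimorphic: they are jointly
epimorphic, and the pair is left orthogonal to every monomorphism. -/
structure JointlyStrongEpi {X Y B : C} (f : X ⟶ B) (g : Y ⟶ B) : Prop where
  jointlyEpi : ∀ ⦃Z : C⦄ (a b : B ⟶ Z), f ≫ a = f ≫ b → g ≫ a = g ≫ b → a = b
  exists_lift : ∀ ⦃M N : C⦄ (m : M ⟶ N) [Mono m] (v : B ⟶ N) (a : X ⟶ M) (b : Y ⟶ M),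
    a ≫ m = f ≫ v → b ≫ m = g ≫ v → ∃ d : B ⟶ M, d ≫ m = v ∧ f ≫ d = a ∧ g ≫ d = b

/-- A point over `B` with domain `A`: a split epimorphism together with a fixed section. -/
structure Point (A B : C) where
  /-- the split epimorphism -/
  π : A ⟶ B
  /-- the section -/
  σ : B ⟶ A
  σ_π : σ ≫ π = 𝟙 B

namespace Point

/-- The point `(π₂, ⟨1, 1⟩)` over `Y` with domain `Y × Y`. -/
noncomputable def sndDiag [HasFiniteLimits C] (Y : C) : Point (Y ⨯ Y) Y where
  π := prod.snd
  σ := diag Y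
  σ_π := prod.lift_snd _ _

/-- The pullback of a point over `B` along a morphism `g : D ⟶ B`, with the induced section
`⟨g ≫ σ, 1⟩`. -/
noncomputable def baseChange [HasFiniteLimits C] {A B : C} (p : Point A B) {D : C} (g : D ⟶ B) :
    Point (pullback p.π g) D where
  π := pullback.snd p.π g
  σ := pullback.lift (g ≫ p.σ) (𝟙 D) (by rw [Category.assoc, p.σ_π, Category.comp_id,
    Category.id_comp])
  σ_π := pullback.lift_snd _ _ _

variable [HasZeroMorphisms C] [HasFiniteLimits C]

/-- A point is strong if the kernel of the split epimorphism and the section are jointly strongly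
epimorphic. -/
def IsStrong {A B : C} (p : Point A B) : Prop :=
  JointlyStrongEpi (kernel.ι p.π) p.σ

/-- A point is stably strong if all its pullbacks are strong. -/
def IsStablyStrong {A B : C} (p : Point A B) : Prop :=
  ∀ ⦃D : C⦄ (g : D ⟶ B), (p.baseChange g).IsStrong

end Point

/-- `Y` is a strongly unital object: the point `(π₂, ⟨1, 1⟩) : Y × Y ⇄ Y` is stably strong. -/
def IsStronglyUnitalObject [HasZeroMorphisms C] [HasFiniteLimits C] (Y : C) : Prop :=
  (Point.sndDiag Y).IsStablyStrong

/-- `Y` is a Mal'tsev object: for all points `(f, s) : A ⇄ Y` and `(g, t) : D ⇄ Y`, the morphisms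
`⟨1, t f⟩ : A ⟶ A ×_Y D` and `⟨s g, 1⟩ : D ⟶ A ×_Y D` are jointly strongly epimorphic. -/
def IsMaltsevObject [HasFiniteLimits C] (Y : C) : Prop :=
  ∀ ⦃A D : C⦄ (p : Point A Y) (q : Point D Y),
    JointlyStrongEpi
      (pullback.lift (f := p.π) (g := q.π) (𝟙 A) (p.π ≫ q.σ) (by
        rw [Category.assoc, q.σ_π, Category.comp_id, Category.id_comp]))
      (pullback.lift (f := p.π) (g := q.π) (q.π ≫ p.σ) (𝟙 D) (by
        rw [Category.assoc, p.σ_π, Category.comp_id, Category.id_comp]))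

/-- `Y` is a protomodular object: every point over `Y` is stably strong. -/
def IsProtomodularObject [HasZeroMorphisms C] [HasFiniteLimits C] (Y : C) : Prop :=
  ∀ ⦃A : C⦄ (p : Point A Y), p.IsStablyStrong

end Points

end CategoryTheory

/-- Right-preordered groups (written additively, not assumed commutative): groups with a preorder
such that `x ≤ y` implies `x + z ≤ y + z`. -/
structure ROrdGrp where
  of ::
  /-- the underlying type -/
  carrier : Type u
  [addGroup : AddGroup carrier]
  [preorder : Preorder carrier]
  [addRightMono : AddRightMono carrier]

namespace ROrdGrp

attribute [instance] addGroup preorder addRightMono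

instance : CoeSort ROrdGrp.{u} (Type u) := ⟨ROrdGrp.carrier⟩

attribute [coe] ROrdGrp.carrier

/-- Morphisms of right-preordered groups: monotone group homomorphisms. -/
@[ext]
structure Hom (X Y : ROrdGrp.{u}) where
  hom' : X →+o Y

instance : Category ROrdGrp.{u} where
  Hom X Y := Hom X Y
  id X := ⟨OrderAddMonoidHom.id X⟩
  comp f g := ⟨g.hom'.comp f.hom'⟩

instance : ConcreteCategory ROrdGrp.{u} (fun X Y => X →+o Y) where
  hom := Hom.hom'
  ofHom := Hom.mk

/-- A monotone group homomorphism as a morphism of `ROrdGrp`. -/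
abbrev ofHom {X Y : ROrdGrp.{u}} (f : X →+o Y) : X ⟶ Y :=
  ConcreteCategory.ofHom (C := ROrdGrp) f

@[ext]
lemma hom_ext {X Y : ROrdGrp.{u}} {f g : X ⟶ Y} (w : ∀ x : X, f x = g x) : f = g :=
  ConcreteCategory.hom_ext _ _ w

/-- The positive cone `P_X = {x | 0 ≤ x}`, a submonoid of `X`. -/
def positiveCone (X : ROrdGrp.{u}) : AddSubmonoid X where
  carrier := {x | 0 ≤ x}
  zero_mem' := le_refl (0 : X)
  add_mem' {x y} hx hy := by
    have h : (0 : X) + y ≤ x + y := add_le_add_left hx y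
    rw [zero_add] at h
    exact le_trans hy h

instance : HasZeroMorphisms ROrdGrp.{u} where
  zero X Y := ⟨ofHom 0⟩
  comp_zero _ _ := rfl
  zero_comp X Y Z f := by
    ext x
    exact map_zero (ConcreteCategory.hom f)

/-- The pullback of `f : X ⟶ Z` and `g : Y ⟶ Z`: the subgroup `{(x, y) | f x = g y}` of `X × Y`
with the componentwise preorder. -/
def pullbackObj {X Y Z : ROrdGrp.{u}} (f : X ⟶ Z) (g : Y ⟶ Z) : ROrdGrp.{u} :=
  letI S : AddSubgroup (X × Y) :=
    { carrier := {p | f p.1 = g p.2}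
      zero_mem' := by
        change f 0 = g 0
        rw [map_zero, map_zero]
      add_mem' := fun {p q} (hp : f p.1 = g p.2) (hq : f q.1 = g q.2) => by
        change f (p.1 + q.1) = g (p.2 + q.2)
        rw [map_add, map_add, hp, hq]
      neg_mem' := fun {p} (hp : f p.1 = g p.2) => by
        change f (-p.1) = g (-p.2)
        rw [map_neg, map_neg, hp] }
  haveI : AddRightMono S := ⟨fun r _ _ h =>
    ⟨add_le_add_left (α := X) h.1 r.1.1, add_le_add_left (α := Y) h.2 r.1.2⟩⟩
  of S

/-- The pullback cone on `pullbackObj f g` given by the two projections. -/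
def pullbackCone {X Y Z : ROrdGrp.{u}} (f : X ⟶ Z) (g : Y ⟶ Z) : PullbackCone f g :=
  PullbackCone.mk (W := pullbackObj f g)
    (ofHom
      { toFun := fun p => p.1.1
        map_zero' := rfl
        map_add' := fun _ _ => rfl
        monotone' := fun _ _ h => h.1 })
    (ofHom
      { toFun := fun p => p.1.2
        map_zero' := rfl
        map_add' := fun _ _ => rfl
        monotone' := fun _ _ h => h.2 })
    (hom_ext fun p => p.2)

/-- `pullbackCone f g` is a limit cone. -/
def pullbackConeIsLimit {X Y Z : ROrdGrp.{u}} (f : X ⟶ Z) (g : Y ⟶ Z) :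
    IsLimit (pullbackCone f g) :=
  PullbackCone.IsLimit.mk _
    (fun s => ofHom
      { toFun := fun w => ⟨(s.fst w, s.snd w), ConcreteCategory.congr_hom s.condition w⟩
        map_zero' := Subtype.ext (Prod.ext (map_zero (ConcreteCategory.hom s.fst))
          (map_zero (ConcreteCategory.hom s.snd)))
        map_add' := fun a b => Subtype.ext (Prod.ext (map_add (ConcreteCategory.hom s.fst) a b)
          (map_add (ConcreteCategory.hom s.snd) a b))
        monotone' := fun _ _ h => ⟨(ConcreteCategory.hom s.fst).monotone' h,
          (ConcreteCategory.hom s.snd).monotone' h⟩ })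
    (fun _ => rfl)
    (fun _ => rfl)
    (fun _ _ h₁ h₂ => hom_ext fun w => Subtype.ext (Prod.ext (ConcreteCategory.congr_hom h₁ w)
      (ConcreteCategory.congr_hom h₂ w)))

instance : HasPullbacks ROrdGrp.{u} :=
  haveI : ∀ {X Y Z : ROrdGrp.{u}} {f : X ⟶ Z} {g : Y ⟶ Z}, HasLimit (cospan f g) :=
    fun {_ _ _ f g} => ⟨⟨⟨pullbackCone f g, pullbackConeIsLimit f g⟩⟩⟩
  hasPullbacks_of_hasLimit_cospan _

instance : HasTerminal ROrdGrp.{u} :=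
  haveI : AddRightMono PUnit.{u + 1} := ⟨fun _ _ _ _ => le_refl _⟩
  IsTerminal.hasTerminal (X := of PUnit.{u + 1})
    (IsTerminal.ofUniqueHom (fun _ => 0) (fun _ _ => hom_ext fun _ => rfl))

instance : HasFiniteLimits ROrdGrp.{u} :=
  hasFiniteLimits_of_hasTerminal_and_pullbacks

end ROrdGrp

namespace ROrdGrp

/-! Everything reduces to: `0 ≤ y` implies `0 ≤ -y` in `Y`. If this holds, a positive element of a
pullback of a point is a kernel element plus a value of the section, both positive, because
subtracting a value of the section is adding a positive element
(`jointlyStrongEpi_of_decomposition`, `sub_section_nonneg`). Conversely, shrinking the positive cone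
of `E` to a submonoid makes the identity a monomorphism, so for a jointly strongly epimorphic pair
the cone cannot be shrunk while keeping the images of both cones (`mem_of_jointlyStrongEpi`).
Applied to `reflectingCone` on pullbacks built from `Y × Y`, this forces positive elements of `Y` to
have positive negatives. -/

lemma comp_hom_apply {X Y Z : ROrdGrp.{u}} (f : X ⟶ Y) (g : Y ⟶ Z) (x : X) :
    (f ≫ g) x = g (f x) := rfl

lemma id_hom_apply {X : ROrdGrp.{u}} (x : X) : (𝟙 X : X ⟶ X) x = x := rfl

lemma add_nonneg_of_nonneg {X : ROrdGrp.{u}} {x y : X} (hx : 0 ≤ x) (hy : 0 ≤ y) : 0 ≤ x + y :=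
  X.positiveCone.add_mem hx hy

lemma map_nonneg_of_nonneg {X Y : ROrdGrp.{u}} (f : X ⟶ Y) {x : X} (hx : 0 ≤ x) : 0 ≤ f x := by
  have h := (ConcreteCategory.hom f).monotone' hx
  change f 0 ≤ f x at h
  rwa [map_zero] at h

lemma sub_nonneg_of_le {X : ROrdGrp.{u}} {x y : X} (h : x ≤ y) : 0 ≤ y + -x := by
  have := add_le_add_left h (-x)
  rwa [add_neg_cancel] at this

lemma le_of_sub_nonneg {X : ROrdGrp.{u}} {x y : X} (h : 0 ≤ y + -x) : x ≤ y := by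
  have := add_le_add_left h x
  rwa [zero_add, neg_add_cancel_right] at this

/-- A group homomorphism preserving positive elements, as a morphism. -/
def homOfNonneg {X Y : ROrdGrp.{u}} (f : X →+ Y) (hf : ∀ x : X, 0 ≤ x → 0 ≤ f x) : X ⟶ Y :=
  ofHom
    { f with
      monotone' := fun x y h => le_of_sub_nonneg (by
        have := hf _ (sub_nonneg_of_le h)
        rwa [map_add, map_neg] at this) }

lemma injective_of_mono {X Y : ROrdGrp.{u}} (m : X ⟶ Y) [Mono m] : Function.Injective m := by
  intro x y h
  have e : (pullbackCone m m).fst = (pullbackCone m m).snd :=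
    (cancel_mono m).1 (pullbackCone m m).condition
  exact ConcreteCategory.congr_hom e (⟨(x, y), h⟩ : pullbackObj m m)

/-! ### Elements and positivity in pullbacks and kernels. -/

section Limits

variable {X Y Z : ROrdGrp.{u}}

/-- The comparison map from the concrete model `pullbackObj f g` is monotone, so it transports
positivity to the chosen pullback. -/
lemma exists_pullback_mk (f : X ⟶ Z) (g : Y ⟶ Z) (x : X) (y : Y) (h : f x = g y) :
    ∃ e : (pullback f g : ROrdGrp.{u}), pullback.fst f g e = x ∧ pullback.snd f g e = y ∧
      (0 ≤ x → 0 ≤ y → 0 ≤ e) := by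
  let l : pullbackObj f g ⟶ pullback f g :=
    pullback.lift (pullbackCone f g).fst (pullbackCone f g).snd (pullbackCone f g).condition
  let p : pullbackObj f g := ⟨(x, y), h⟩
  refine ⟨l p, ?_, ?_, fun hx hy => map_nonneg_of_nonneg l (x := p) ⟨hx, hy⟩⟩
  · exact ConcreteCategory.congr_hom (pullback.lift_fst _ _ (pullbackCone f g).condition) p
  · exact ConcreteCategory.congr_hom (pullback.lift_snd _ _ (pullbackCone f g).condition) p

lemma pullback_elem_ext (f : X ⟶ Z) (g : Y ⟶ Z) {e e' : (pullback f g : ROrdGrp.{u})}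
    (h₁ : pullback.fst f g e = pullback.fst f g e')
    (h₂ : pullback.snd f g e = pullback.snd f g e') : e = e' := by
  let r : pullback f g ⟶ pullbackObj f g :=
    (pullbackConeIsLimit f g).lift (PullbackCone.mk _ _ pullback.condition)
  let l : pullbackObj f g ⟶ pullback f g :=
    pullback.lift (pullbackCone f g).fst (pullbackCone f g).snd (pullbackCone f g).condition
  have hrl : r ≫ l = 𝟙 _ := by
    apply pullback.hom_ext
    · rw [Category.assoc, show l ≫ pullback.fst f g = _ from pullback.lift_fst _ _ _,
        Category.id_comp]
      rfl
    · rw [Category.assoc, show l ≫ pullback.snd f g = _ from pullback.lift_snd _ _ _,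
        Category.id_comp]
      rfl
  have hr : r e = r e' := Subtype.ext (Prod.ext h₁ h₂)
  have k := fun z => ConcreteCategory.congr_hom hrl z
  calc e = l (r e) := (k e).symm
    _ = l (r e') := by rw [hr]
    _ = e' := k e'

lemma pullback_nonneg (f : X ⟶ Z) (g : Y ⟶ Z) {e : (pullback f g : ROrdGrp.{u})}
    (h₁ : 0 ≤ pullback.fst f g e) (h₂ : 0 ≤ pullback.snd f g e) : 0 ≤ e := by
  obtain ⟨e', h₁', h₂', he'⟩ := exists_pullback_mk f g (pullback.fst f g e) (pullback.snd f g e)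
    (ConcreteCategory.congr_hom pullback.condition e)
  rw [pullback_elem_ext f g h₁'.symm h₂'.symm]
  exact he' h₁ h₂

lemma exists_kernel_mk (f : X ⟶ Y) (x : X) (h : f x = 0) :
    ∃ k : (kernel f : ROrdGrp.{u}), kernel.ι f k = x ∧ (0 ≤ x → 0 ≤ k) := by
  let c := pullbackCone f (0 : X ⟶ Y)
  have hc : c.fst ≫ f = 0 := by rw [c.condition, comp_zero]
  let p : pullbackObj f (0 : X ⟶ Y) := ⟨(x, 0), h⟩
  refine ⟨kernel.lift f c.fst hc p, ?_, fun hx =>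
    map_nonneg_of_nonneg (kernel.lift f c.fst hc) (x := p) ⟨hx, le_refl (0 : X)⟩⟩
  exact ConcreteCategory.congr_hom (kernel.lift_ι f c.fst hc) p

end Limits

/-! ### Positive cones and joint strong epimorphy. -/

section JointlyStrongEpi

variable {X Z E : ROrdGrp.{u}} {f : X ⟶ E} {g : Z ⟶ E}

/-- Two morphisms are jointly strongly epimorphic if every element of the codomain is a sum of
values of the two, with the summands coming from positive elements when the sum is positive. -/
lemma jointlyStrongEpi_of_decomposition
    (H : ∀ e : E, ∃ (x : X) (z : Z), f x + g z = e ∧ (0 ≤ e → 0 ≤ x ∧ 0 ≤ z)) :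
    JointlyStrongEpi f g where
  jointlyEpi W a b hf hg := by
    ext e
    obtain ⟨x, z, rfl, -⟩ := H e
    have h₁ : a (f x) = b (f x) := ConcreteCategory.congr_hom hf x
    have h₂ : a (g z) = b (g z) := ConcreteCategory.congr_hom hg z
    rw [map_add, map_add, h₁, h₂]
  exists_lift M N m _ v a b ha hb := by
    have hm := injective_of_mono m
    have ha' : ∀ x, m (a x) = v (f x) := fun x => ConcreteCategory.congr_hom ha x
    have hb' : ∀ z, m (b z) = v (g z) := fun z => ConcreteCategory.congr_hom hb z
    choose x z hxz hpos using H
    have key : ∀ e, m (a (x e) + b (z e)) = v e := fun e => by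
      rw [map_add, ha', hb', ← map_add, hxz]
    -- The chosen decompositions need not be additive in `e`; additivity of `d` comes from that of
    -- `v` and injectivity of `m`.
    let d : E →+ M := AddMonoidHom.mk' (fun e => a (x e) + b (z e)) fun e e' => hm (by
      rw [key, map_add, map_add (ConcreteCategory.hom m), key, key])
    have hd : homOfNonneg d (fun e he => add_nonneg_of_nonneg
        (map_nonneg_of_nonneg a (hpos e he).1) (map_nonneg_of_nonneg b (hpos e he).2)) ≫ m = v :=
      hom_ext key
    refine ⟨_, hd, ?_, ?_⟩
    · rw [← cancel_mono m, Category.assoc, hd, ha]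
    · rw [← cancel_mono m, Category.assoc, hd, hb]

/-- The group `X` with the preorder whose positive cone is the submonoid `S`. -/
def withCone (X : ROrdGrp.{u}) (S : AddSubmonoid X) : ROrdGrp.{u} :=
  letI : Preorder X :=
    { le := fun x y => y + -x ∈ S
      lt := fun x y => y + -x ∈ S ∧ ¬ x + -y ∈ S
      le_refl := fun x => by
        rw [add_neg_cancel]
        exact S.zero_mem
      le_trans := fun x y z hxy hyz => by
        have := S.add_mem hyz hxy
        rwa [← add_assoc, neg_add_cancel_right] at this }
  -- Only right translations must be monotone, so `S` need not be closed under conjugation.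
  haveI : AddRightMono X := ⟨fun z x y (h : y + -x ∈ S) => by
    change y + z + -(x + z) ∈ S
    rwa [neg_add_rev, ← add_assoc, add_neg_cancel_right]⟩
  of X

lemma withCone_nonneg_iff (X : ROrdGrp.{u}) (S : AddSubmonoid X) (x : X) :
    @LE.le (withCone X S) _ (0 : X) x ↔ x ∈ S := by
  change x + -0 ∈ S ↔ _
  rw [neg_zero, add_zero]

/-- If two morphisms are jointly strongly epimorphic, then a submonoid of the codomain contains the
positive cone as soon as it consists of positive elements and contains the images of the positive
cones of the domains. -/
lemma mem_of_jointlyStrongEpi (H : JointlyStrongEpi f g) (S : AddSubmonoid E)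
    (hS : ∀ e ∈ S, 0 ≤ e) (hf : ∀ x, 0 ≤ x → f x ∈ S) (hg : ∀ z, 0 ≤ z → g z ∈ S)
    {e : E} (he : 0 ≤ e) : e ∈ S := by
  let m : withCone E S ⟶ E := homOfNonneg (X := withCone E S) (AddMonoidHom.id E)
    fun x hx => hS x ((withCone_nonneg_iff E S x).1 hx)
  have : Mono m := ⟨fun a b h => hom_ext fun x => ConcreteCategory.congr_hom h x⟩
  let a : X ⟶ withCone E S := homOfNonneg (Y := withCone E S)
    ((ConcreteCategory.hom f : X →+o E) : X →+ E)
    fun x hx => (withCone_nonneg_iff E S _).2 (hf x hx)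
  let b : Z ⟶ withCone E S := homOfNonneg (Y := withCone E S)
    ((ConcreteCategory.hom g : Z →+o E) : Z →+ E)
    fun x hx => (withCone_nonneg_iff E S _).2 (hg x hx)
  -- The lift of `𝟙 E` through `m` is the identity on elements; its monotonicity is the desired
  -- inclusion of cones.
  obtain ⟨d, hd, -, -⟩ := H.exists_lift m (𝟙 E) a b (hom_ext fun _ => rfl) (hom_ext fun _ => rfl)
  have h₁ : d e = e := ConcreteCategory.congr_hom hd e
  have h₂ := map_nonneg_of_nonneg d he
  rw [h₁] at h₂
  exact (withCone_nonneg_iff E S e).1 h₂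

end JointlyStrongEpi

/-- The positive elements of `E` whose image under `w` is invertible in the positive cone as soon as
their images under `u₁` and `u₂` are. -/
def reflectingCone {E Y : ROrdGrp.{u}} (u₁ u₂ w : E ⟶ Y) : AddSubmonoid E where
  carrier := {e | 0 ≤ e ∧ (0 ≤ -u₁ e → 0 ≤ -u₂ e → 0 ≤ -w e)}
  zero_mem' := ⟨le_refl _, fun _ _ => by rw [map_zero, neg_zero]⟩
  add_mem' {e e'} h h' := by
    refine ⟨add_nonneg_of_nonneg h.1 h'.1, fun h₁ h₂ => ?_⟩
    -- From `0 ≤ -v e' + -v e`, adding the positive `v e'` on the left or `v e` on the right cancels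
    -- one term.
    have split : ∀ v : E ⟶ Y, 0 ≤ -v (e + e') → 0 ≤ -v e ∧ 0 ≤ -v e' := fun v hv => by
      rw [map_add, neg_add_rev] at hv
      constructor
      · have := add_nonneg_of_nonneg (map_nonneg_of_nonneg v h'.1) hv
        rwa [add_neg_cancel_left] at this
      · have := add_nonneg_of_nonneg hv (map_nonneg_of_nonneg v h.1)
        rwa [neg_add_cancel_right] at this
    rw [map_add, neg_add_rev]
    exact add_nonneg_of_nonneg (h'.2 (split u₁ h₁).2 (split u₂ h₂).2)
      (h.2 (split u₁ h₁).1 (split u₂ h₂).1)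

/-- If `f` and `g` are jointly strongly epimorphic and `i` is a section of `w` on which `u₁` and
`u₂` vanish, then the positive cone of `Y` is a group provided that the images of `f` and `g` lie in
the reflecting cone. -/
lemma neg_nonneg_of_jointlyStrongEpi {X Z E Y : ROrdGrp.{u}} {f : X ⟶ E} {g : Z ⟶ E}
    (H : JointlyStrongEpi f g) (u₁ u₂ w : E ⟶ Y) (i : Y ⟶ E)
    (hf : ∀ x, 0 ≤ -u₁ (f x) → 0 ≤ -u₂ (f x) → 0 ≤ -w (f x))
    (hg : ∀ z, 0 ≤ -u₁ (g z) → 0 ≤ -u₂ (g z) → 0 ≤ -w (g z))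
    (h₁ : i ≫ u₁ = 0) (h₂ : i ≫ u₂ = 0) (hw : i ≫ w = 𝟙 Y) (y : Y) (hy : 0 ≤ y) : 0 ≤ -y := by
  have h := (mem_of_jointlyStrongEpi H (reflectingCone u₁ u₂ w) (fun _ h => h.1)
    (fun x hx => ⟨map_nonneg_of_nonneg f hx, hf x⟩) (fun z hz => ⟨map_nonneg_of_nonneg g hz, hg z⟩)
    (map_nonneg_of_nonneg i hy)).2
  have e₁ : u₁ (i y) = 0 := ConcreteCategory.congr_hom h₁ y
  have e₂ : u₂ (i y) = 0 := ConcreteCategory.congr_hom h₂ y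
  have e₃ : w (i y) = y := ConcreteCategory.congr_hom hw y
  rw [e₁, e₂, e₃, neg_zero] at h
  exact h (le_refl _) (le_refl _)

/-! ### The implications between the conditions. -/

variable {Y : ROrdGrp.{u}}

/-- Let `u`, `w` be the two coordinates on `Y × Y`. On the kernel `w = 0`, on the diagonal `u = w`,
and the test element is `(0, y)`. Pulling back along `𝟙 Y` suffices. -/
lemma neg_nonneg_of_isStronglyUnitalObject (H : IsStronglyUnitalObject Y) (y : Y) (hy : 0 ≤ y) :
    0 ≤ -y := by
  have hS : JointlyStrongEpi _ _ := H (𝟙 Y)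
  let p := (Point.sndDiag Y).π
  let u : pullback p (𝟙 Y) ⟶ Y := pullback.fst p (𝟙 Y) ≫ prod.fst
  let w : pullback p (𝟙 Y) ⟶ Y := pullback.snd p (𝟙 Y)
  let i : Y ⟶ pullback p (𝟙 Y) := pullback.lift (prod.lift 0 (𝟙 Y)) (𝟙 Y)
    (by rw [Category.comp_id]; exact prod.lift_snd _ _)
  have hk : kernel.ι w ≫ w = 0 := kernel.condition w
  have hs : ((Point.sndDiag Y).baseChange (𝟙 Y)).σ ≫ u =
      ((Point.sndDiag Y).baseChange (𝟙 Y)).σ ≫ w := by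
    dsimp only [u, w, p, Point.baseChange]
    rw [pullback.lift_fst_assoc, pullback.lift_snd, Category.id_comp]
    exact prod.lift_fst _ _
  refine neg_nonneg_of_jointlyStrongEpi hS u u w i (fun k _ _ => ?_) (fun z h _ => ?_) ?_ ?_ ?_ y hy
  · have : w (kernel.ι w k) = 0 := ConcreteCategory.congr_hom hk k
    change 0 ≤ -w (kernel.ι w k)
    rw [this, neg_zero]
  · exact (ConcreteCategory.congr_hom hs z) ▸ h
  · rw [pullback.lift_fst_assoc]; exact prod.lift_fst _ _
  · rw [pullback.lift_fst_assoc]; exact prod.lift_fst _ _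
  · exact pullback.lift_snd _ _ _

/-- The pullback consists of triples `(a, b, c)`, with `u₁ = a`, `u₂ = b`, `w = c`. The two maps
have images `(a, c, c)` and `(c, b, c)`, where `w` equals `u₂` or `u₁`; the test element is `(0, 0,
y)`. -/
lemma neg_nonneg_of_isMaltsevObject (H : IsMaltsevObject Y) (y : Y) (hy : 0 ≤ y) : 0 ≤ -y := by
  have hS := H (Point.sndDiag Y) (Point.sndDiag Y)
  let p := (Point.sndDiag Y).π
  let j : Y ⟶ Y ⨯ Y := prod.lift 0 (𝟙 Y)
  have hj : j ≫ p = 𝟙 Y := prod.lift_snd _ _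
  have hj' : j ≫ prod.fst = 0 := prod.lift_fst _ _
  have hσ : (Point.sndDiag Y).σ ≫ prod.fst = 𝟙 Y := prod.lift_fst _ _
  refine neg_nonneg_of_jointlyStrongEpi hS (pullback.fst p p ≫ prod.fst)
    (pullback.snd p p ≫ prod.fst) (pullback.fst p p ≫ p) (pullback.lift j j rfl)
    (fun x _ h => ?_) (fun z h _ => ?_) ?_ ?_ ?_ y hy
  · rw [← comp_hom_apply, pullback.lift_snd_assoc, Category.assoc, hσ, Category.comp_id] at h
    rwa [← comp_hom_apply, pullback.lift_fst_assoc, Category.id_comp]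
  · rw [← comp_hom_apply, pullback.lift_fst_assoc, Category.assoc, hσ, Category.comp_id] at h
    rwa [← comp_hom_apply, pullback.condition, pullback.lift_snd_assoc, Category.id_comp]
  · rw [pullback.lift_fst_assoc, hj']
  · rw [pullback.lift_snd_assoc, hj']
  · rw [pullback.lift_fst_assoc, hj]

/-- If the positive cone of the base is a group, then subtracting from a positive element the value
of the section leaves it positive. -/
lemma sub_section_nonneg (hY : ∀ y : Y, 0 ≤ y → 0 ≤ -y) {A : ROrdGrp.{u}} (s : Y ⟶ A)
    {a : A} (ha : 0 ≤ a) {y : Y} (hy : 0 ≤ y) : 0 ≤ a + -s y := by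
  rw [← map_neg]
  exact add_nonneg_of_nonneg ha (map_nonneg_of_nonneg s (hY y hy))

lemma isProtomodularObject_of_neg_nonneg (hY : ∀ y : Y, 0 ≤ y → 0 ≤ -y) :
    IsProtomodularObject Y := by
  intro A p D g
  have hσ₁ : ∀ d, pullback.fst p.π g ((p.baseChange g).σ d) = p.σ (g d) :=
    ConcreteCategory.congr_hom (pullback.lift_fst (f := p.π) (g := g) _ _ _)
  have hσ₂ : ∀ d, pullback.snd p.π g ((p.baseChange g).σ d) = d :=
    ConcreteCategory.congr_hom (pullback.lift_snd (f := p.π) (g := g) _ _ _)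
  refine jointlyStrongEpi_of_decomposition fun e => ?_
  let d := pullback.snd p.π g e
  have hker : pullback.snd p.π g (e + -(p.baseChange g).σ d) = 0 := by
    rw [map_add, map_neg, hσ₂, add_neg_cancel]
  obtain ⟨k, hk, hk'⟩ := exists_kernel_mk (p.baseChange g).π (e + -(p.baseChange g).σ d) hker
  refine ⟨k, d, ?_, fun he => ?_⟩
  · rw [hk, neg_add_cancel_right]
  · have hd : 0 ≤ d := map_nonneg_of_nonneg _ he
    -- The second coordinate of the kernel part is zero, so only the first needs the hypothesis on
    -- `Y`.
    refine ⟨hk' (pullback_nonneg _ _ ?_ hker.ge), hd⟩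
    rw [map_add, map_neg, hσ₁]
    exact sub_section_nonneg hY p.σ (map_nonneg_of_nonneg _ he) (map_nonneg_of_nonneg g hd)

lemma isMaltsevObject_of_neg_nonneg (hY : ∀ y : Y, 0 ≤ y → 0 ≤ -y) : IsMaltsevObject Y := by
  intro A D p q
  refine jointlyStrongEpi_of_decomposition fun e => ?_
  have hπσ : ∀ y, p.π (p.σ y) = y := ConcreteCategory.congr_hom p.σ_π
  have hcond : p.π (pullback.fst p.π q.π e) = q.π (pullback.snd p.π q.π e) :=
    ConcreteCategory.congr_hom pullback.condition e
  -- With `e = (a, b)` and `x = a - s (f a)`, one has `f x = 0`, so `e = (x, 0) + (s (g b), b)`.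
  refine ⟨pullback.fst p.π q.π e + -p.σ (p.π (pullback.fst p.π q.π e)), pullback.snd p.π q.π e,
    pullback_elem_ext _ _ ?_ ?_, fun he => ?_⟩
  · rw [map_add, ← comp_hom_apply, ← comp_hom_apply _ (pullback.fst p.π q.π), pullback.lift_fst,
      pullback.lift_fst, id_hom_apply, comp_hom_apply, ← hcond, neg_add_cancel_right]
  · rw [map_add, ← comp_hom_apply, ← comp_hom_apply _ (pullback.snd p.π q.π), pullback.lift_snd,
      pullback.lift_snd, id_hom_apply, comp_hom_apply,
      map_add (ConcreteCategory.hom p.π), map_neg (ConcreteCategory.hom p.π), hπσ, add_neg_cancel, map_zero, zero_add]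
  · have ha := map_nonneg_of_nonneg (pullback.fst p.π q.π) he
    exact ⟨sub_section_nonneg hY p.σ ha (map_nonneg_of_nonneg p.π ha), map_nonneg_of_nonneg _ he⟩

lemma forall_isAddUnit_positiveCone_iff :
    (∀ x : Y.positiveCone, IsAddUnit x) ↔ ∀ y : Y, 0 ≤ y → 0 ≤ -y := by
  constructor
  · intro h y hy
    obtain ⟨b, hb⟩ := (h ⟨y, hy⟩).exists_neg
    have : y + (b : Y) = 0 := congrArg Subtype.val hb
    rw [neg_eq_of_add_eq_zero_right this]
    exact b.2
  · rintro h ⟨y, hy⟩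
    exact ⟨⟨⟨y, hy⟩, ⟨-y, h y hy⟩, Subtype.ext (add_neg_cancel y),
      Subtype.ext (neg_add_cancel y)⟩, rfl⟩

lemma equivalence_le_iff :
    _root_.Equivalence (fun x y : Y => x ≤ y) ↔ ∀ y : Y, 0 ≤ y → 0 ≤ -y := by
  constructor
  · intro h y hy
    have := sub_nonneg_of_le (h.symm hy)
    rwa [zero_add] at this
  · refine fun h => ⟨le_refl, fun {x y} hxy => le_of_sub_nonneg ?_, fun h₁ h₂ => le_trans h₁ h₂⟩
    have := h _ (sub_nonneg_of_le hxy)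
    rwa [neg_add_rev, neg_neg] at this

end ROrdGrp

theorem theorem3p4 (Y : ROrdGrp.{u}) :
    List.TFAE [
      IsProtomodularObject Y,
      IsMaltsevObject Y,
      IsStronglyUnitalObject Y,
      ∀ x : Y.positiveCone, IsAddUnit x,
      _root_.Equivalence (fun x y : Y => x ≤ y)] := by
  rw [ROrdGrp.forall_isAddUnit_positiveCone_iff, ROrdGrp.equivalence_le_iff]
  tfae_have 1 → 3 := fun h => h (Point.sndDiag Y)
  tfae_have 3 → 4 := ROrdGrp.neg_nonneg_of_isStronglyUnitalObject
  tfae_have 2 → 4 := ROrdGrp.neg_nonneg_of_isMaltsevObject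
  tfae_have 4 → 1 := ROrdGrp.isProtomodularObject_of_neg_nonneg
  tfae_have 4 → 2 := ROrdGrp.isMaltsevObject_of_neg_nonneg
  tfae_have 4 ↔ 5 := Iff.rfl
  tfae_finish
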